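/- Let $T>0$, $\rho>0$, $\theta\ge 0$ and $x,y\in\mathbb{R}$, and let $(\Omega,\mathscr{F},(\mathscr{F}_t)_{t\ge0},\mathbb{P})$ be a filtered probability space. For $z\in\mathbb{R}$ let $\mathscr{X}(z,[0,T])$ be the class of all real-valued processes $(Z_t)_{t\ge 0-}$ with $Z_{0-}=z$ such that $(Z_t)_{t\ge0}$ is adapted to $(\mathscr{F}_t)_{t\ge0}$, $t\mapsto Z_t$ is $\mathbb{P}$-a.s. right-continuous, both $Z$ and its total variation over $t\ge0-$ are $\mathbb{P}$-a.s. bounded by a deterministic constant, and $\mathbb{P}$-a.s. $Z_t=0$ for all $t\ge T$. For $X\in\mathscr{X}(x,[0,T])$ and $Y\in\mathscr{X}(y,[0,T])$ the liquidation costs of $X$ given $Y$ are $$\mathscr{C}(X|Y)=\frac12\int_{[0,T]}\int_{[0,T]}e^{-\rho|t-s|}\,dX_s\,dX_t+\int_{[0,T]}\int_{[0,t)}e^{-\rho(t-s)}\,dY_s\,dX_t+\frac12\sum_{t\in[0,T]}\Delta X_t\,\Delta Y_t+\theta\sum_{t\in[0,T]}(\Delta X_t)^2,$$ where the integrals are Stieltjes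 integrals that include the jump at time $0$, $\Delta Z_t=Z_t-Z_{t-}$, and $\mathscr{C}(Y|X)$ is obtained by interchanging the roles of $X$ and $Y$. A Nash equilibrium is a pair $(X^*,Y^*)\in\mathscr{X}(x,[0,T])\times\mathscr{X}(y,[0,T])$ with $$\mathbb{E}[\mathscr{C}(X^*|Y^*)]=\inf_{X\in\mathscr{X}(x,[0,T])}\mathbb{E}[\mathscr{C}(X|Y^*)]\quad\text{and}\quad\mathbb{E}[\mathscr{C}(Y^*|X^*)]=\inf_{Y\in\mathscr{X}(y,[0,T])}\mathbb{E}[\mathscr{C}(Y|X^*)].$$ Then there is at most one Nash equilibrium, up to indistinguishability: if $(X^0,Y^0)$ and $(X^1,Y^1)$ are Nash equilibria, then $\mathbb{P}$-a.s. $X^0_t=X^1_t$ and $Y^0_t=Y^1_t$ for all $t\ge0$. -/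

import Mathlib

open MeasureTheory Set
open scoped NNReal ENNReal

noncomputable section

namespace MarketImpact

/-- The path `(Z_t)_{t ≥ 0-}` with value `z` immediately before time `0`, viewed as a function
on `ℝ` that is constant equal to `z` on `(-∞, 0)`. -/
def extendPath (z : ℝ) (Z : ℝ≥0 → ℝ) (t : ℝ) : ℝ :=
  if t < 0 then z else Z t.toNNReal

/-- The signed Lebesgue-Stieltjes measure `dg` of a function `g` of bounded variation
(and `0` if `g` does not have bounded variation). -/
def stieltjes (g : ℝ → ℝ) : SignedMeasure ℝ :=
  open scoped Classical in
  if h : BoundedVariationOn g univ then h.vectorMeasure else 0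

/-- The jump `Δg_t = g(t) - g(t-)`. -/
def jump (g : ℝ → ℝ) (t : ℝ) : ℝ := g t - Function.leftLim g t

/-- The liquidation costs `𝒞(X|Y)` of one path `X` given another path `Y`, both of them being
indexed by the real line and constant on `(-∞, 0)`. -/
def cost (ρ θ T : ℝ) (X Y : ℝ → ℝ) : ℝ :=
  1 / 2 * (∫ᵛ t in Icc 0 T, (∫ᵛ s in Icc 0 T, Real.exp (-ρ * |t - s|) ∂•(stieltjes X))
      ∂•(stieltjes X))
    + (∫ᵛ t in Icc 0 T, (∫ᵛ s in Ico 0 t, Real.exp (-ρ * (t - s)) ∂•(stieltjes Y))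
      ∂•(stieltjes X))
    + 1 / 2 * (∑' t : Icc (0 : ℝ) T, jump X t * jump Y t)
    + θ * (∑' t : Icc (0 : ℝ) T, jump X t ^ 2)

variable {Ω : Type*} {m : MeasurableSpace Ω}

/-- `Z ∈ 𝒳(z, [0, T])`: the process `(Z_t)_{t ≥ 0}`, completed by the value `Z_{0-} = z`, is an
admissible strategy with time horizon `T`. -/
structure IsAdmissible (P : Measure Ω) (𝓕 : Filtration ℝ≥0 m) (z T : ℝ)
    (Z : ℝ≥0 → Ω → ℝ) : Prop where
  adapted : Adapted 𝓕 Z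
  rightContinuous : ∀ᵐ ω ∂P, ∀ t, ContinuousWithinAt (fun s ↦ Z s ω) (Ici t) t
  bounded : ∃ C : ℝ, ∀ᵐ ω ∂P, ∀ t, |Z t ω| ≤ C
  boundedVariation : ∃ C : ℝ≥0, ∀ᵐ ω ∂P,
    eVariationOn (extendPath z (fun t ↦ Z t ω)) univ ≤ C
  liquidation : ∀ᵐ ω ∂P, ∀ t : ℝ≥0, T ≤ t → Z t ω = 0

/-- The expected liquidation costs `𝔼[𝒞(X|Y)]`, where `X_{0-} = x` and `Y_{0-} = y`. -/
def expectedCost (P : Measure Ω) (ρ θ T x y : ℝ) (X Y : ℝ≥0 → Ω → ℝ) : ℝ :=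
  ∫ ω, cost ρ θ T (extendPath x (fun t ↦ X t ω)) (extendPath y (fun t ↦ Y t ω)) ∂P

/-- `(X, Y)` is a Nash equilibrium in `𝒳(x, [0, T]) × 𝒳(y, [0, T])`. -/
structure IsNashEquilibrium (P : Measure Ω) (𝓕 : Filtration ℝ≥0 m) (ρ θ T x y : ℝ)
    (X Y : ℝ≥0 → Ω → ℝ) : Prop where
  admissible_left : IsAdmissible P 𝓕 x T X
  admissible_right : IsAdmissible P 𝓕 y T Y
  optimal_left : ∀ X', IsAdmissible P 𝓕 x T X' →
    expectedCost P ρ θ T x y X Y ≤ expectedCost P ρ θ T x y X' Y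
  optimal_right : ∀ Y', IsAdmissible P 𝓕 y T Y' →
    expectedCost P ρ θ T y x Y X ≤ expectedCost P ρ θ T y x Y' X

end MarketImpact

end

/-! For equilibria `(X₀, Y₀)` and `(X₁, Y₁)` put `p = X₁ - X₀`, `q = Y₁ - Y₀`. The expected cost of
`X₀ + αp` given `Y₀ + βq` is a polynomial in `(α, β)` of degree two without `β²` term
(`integral_cost_add_mul`). Optimality of `X` makes its `α`-derivative vanish at `(0, 0)` and at `(1,
1)`; subtracting leaves an identity between the `α²` and `αβ` coefficients alone
(`integral_second_order_eq_zero`). The other player gives the same with `p` and `q` exchanged.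

In the sum of both identities the two causal cross terms and the joint jumps merge into the
symmetric form `E(p, q)` with kernel `exp (-ρ|t - s|)`. Since `E(p,p) + E(q,q) + E(p,q) = (E(p,p) +
E(q,q) + E(p+q,p+q))/2` and the `θ` terms are nonnegative, `E(p,p) = E(q,q) = 0` almost surely
(`second_order_eq`, `ae_eq_of_second_order_eq_zero`). The kernel is a Gram kernel in `L²`, which
makes `E` strictly positive definite (`eq_of_kernelForm_exp_self_eq_zero`), so `p = q = 0`.

Bilinearity, symmetry, kernel identities and measurability in `ω` are all obtained from finite
dyadic sums through `tendsto_riemannSum`. -/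

noncomputable section

namespace MarketImpact

open Filter Topology

/-! ### Dyadic partitions and Stieltjes measures of regular paths. -/

section

/-- A right-continuous path on the real line that is constant equal to `z` on `(-∞, 0)` and whose
total variation is at most `V`. -/
structure IsRegularPath (z : ℝ) (V : ℝ≥0) (f : ℝ → ℝ) : Prop where
  variation_le : eVariationOn f univ ≤ V
  rightContinuous : ∀ t, ContinuousWithinAt f (Ici t) t
  initial : ∀ t < 0, f t = z

/-- The `i`-th node of the dyadic partition of `[0, T]` of level `n`. -/
def node (T : ℝ) (n i : ℕ) : ℝ := T * i / 2 ^ n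

/-- The left neighbour of the `i`-th node of the dyadic partition of `[0, T]` of level `n`. -/
def prevNode (T : ℝ) (n i : ℕ) : ℝ := T * (i - 1) / 2 ^ n

/-- The index of the cell `(prevNode T n i, node T n i]` that contains `s`. -/
def cell (T : ℝ) (n : ℕ) (s : ℝ) : ℕ := ⌈s * 2 ^ n / T⌉₊

/-- The increment of a path over the `i`-th cell. -/
def increment (T : ℝ) (n : ℕ) (f : ℝ → ℝ) (i : ℕ) : ℝ := f (node T n i) - f (prevNode T n i)

variable {T : ℝ}

lemma node_nonneg (hT : 0 < T) (n i : ℕ) : 0 ≤ node T n i := by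
  unfold node; positivity

lemma node_mono (hT : 0 < T) (n : ℕ) : Monotone (node T n) := by
  intro i j h
  unfold node
  have : (i : ℝ) ≤ j := by exact_mod_cast h
  gcongr

lemma prevNode_succ (n i : ℕ) : prevNode T n (i + 1) = node T n i := by
  simp [prevNode, node]

lemma prevNode_zero_neg (hT : 0 < T) (n : ℕ) : prevNode T n 0 < 0 := by
  have : 0 < T / 2 ^ n := by positivity
  simp only [prevNode, CharP.cast_eq_zero, zero_sub, mul_neg, mul_one, neg_div]
  linarith

lemma node_sub_prevNode (n i : ℕ) : node T n i - prevNode T n i = T / 2 ^ n := by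
  simp only [node, prevNode]; ring

lemma prevNode_lt_node (hT : 0 < T) (n i : ℕ) : prevNode T n i < node T n i := by
  have : 0 < T / 2 ^ n := by positivity
  have := node_sub_prevNode (T := T) n i
  linarith

lemma node_two_pow (n : ℕ) : node T n (2 ^ n) = T := by
  simp [node]

lemma cell_le_iff (hT : 0 < T) (n : ℕ) (s : ℝ) (i : ℕ) : cell T n s ≤ i ↔ s ≤ node T n i := by
  rw [cell, Nat.ceil_le, node, div_le_iff₀ hT, le_div_iff₀ (by positivity), mul_comm T]

/-- The natural ceiling sends every nonpositive number to `0`, so within `[0, T]` the cell of index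
`0` is the single point `0`, which carries the initial jump. -/
lemma cell_eq_zero_iff (hT : 0 < T) (n : ℕ) (s : ℝ) : cell T n s = 0 ↔ s ≤ 0 := by
  have := cell_le_iff hT n s 0
  simpa [node] using this

lemma cell_eq_succ_iff (hT : 0 < T) (n : ℕ) (s : ℝ) (i : ℕ) :
    cell T n s = i + 1 ↔ s ∈ Ioc (node T n i) (node T n (i + 1)) := by
  rw [mem_Ioc, ← cell_le_iff hT, ← not_le, ← cell_le_iff hT]
  lia

lemma le_node_cell (hT : 0 < T) (n : ℕ) (s : ℝ) : s ≤ node T n (cell T n s) :=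
  (cell_le_iff hT n s _).1 le_rfl

lemma prevNode_cell_lt (hT : 0 < T) (n : ℕ) {s : ℝ} (hs : 0 ≤ s) :
    prevNode T n (cell T n s) < s := by
  rcases h : cell T n s with _ | i
  · exact (prevNode_zero_neg hT n).trans_le hs
  · rw [prevNode_succ]
    exact ((cell_eq_succ_iff hT n s i).1 h).1

lemma cell_le_two_pow (hT : 0 < T) (n : ℕ) {s : ℝ} (hs : s ≤ T) : cell T n s ≤ 2 ^ n := by
  rwa [cell_le_iff hT, node_two_pow]

lemma measurable_cell (n : ℕ) : Measurable (cell T n) :=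
  Nat.measurable_ceil.comp (by fun_prop)

lemma tendsto_mesh : Tendsto (fun n : ℕ ↦ T / 2 ^ n) atTop (𝓝 0) :=
  tendsto_const_nhds.div_atTop (tendsto_pow_atTop_atTop_of_one_lt one_lt_two)

lemma tendsto_node_cell (hT : 0 < T) {s : ℝ} (hs : 0 ≤ s) :
    Tendsto (fun n ↦ node T n (cell T n s)) atTop (𝓝 s) := by
  refine tendsto_of_tendsto_of_tendsto_of_le_of_le tendsto_const_nhds
    (by simpa using tendsto_const_nhds.add tendsto_mesh) (fun n ↦ le_node_cell hT n s) (fun n ↦ ?_)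
    (h := fun n ↦ s + T / 2 ^ n)
  have := prevNode_cell_lt hT n hs
  have := node_sub_prevNode (T := T) n (cell T n s)
  show node T n (cell T n s) ≤ s + T / 2 ^ n
  linarith

lemma tendsto_prevNode_cell (hT : 0 < T) {s : ℝ} (hs : 0 ≤ s) :
    Tendsto (fun n ↦ prevNode T n (cell T n s)) atTop (𝓝 s) := by
  have := (tendsto_node_cell hT hs).sub (tendsto_mesh (T := T))
  rw [sub_zero] at this
  refine this.congr fun n ↦ ?_
  rw [← node_sub_prevNode n (cell T n s)]
  ring

/-- The rectangle `node (cell t), node (cell s)` eventually lies on the same side of the diagonal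
as `(t, s)`. -/
lemma eventually_node_cell_lt (hT : 0 < T) {s t : ℝ} (hs : 0 ≤ s) (hst : s < t) :
    ∀ᶠ n in atTop, node T n (cell T n s) < node T n (cell T n t) :=
  ((tendsto_node_cell hT hs).eventually_lt_const hst).mono
    fun n hn ↦ hn.trans_le (le_node_cell hT n t)

instance (μ : SignedMeasure ℝ) : IsFiniteMeasure μ.variation := by
  rw [← SignedMeasure.totalVariation_eq_variation]
  infer_instance

/-- Dominated convergence against the variation, whose finiteness makes a constant an integrable
bound. -/
lemma tendsto_setIntegral_of_bounded {μ : SignedMeasure ℝ} {A : Set ℝ} (hA : MeasurableSet A)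
    {F : ℕ → ℝ → ℝ} {f : ℝ → ℝ} (K : ℝ) (hF : ∀ n, Measurable (F n))
    (hK : ∀ n, ∀ t ∈ A, |F n t| ≤ K) (h : ∀ t ∈ A, Tendsto (fun n ↦ F n t) atTop (𝓝 (f t))) :
    Tendsto (fun n ↦ ∫ᵛ t in A, F n t ∂•μ) atTop (𝓝 (∫ᵛ t in A, f t ∂•μ)) := by
  refine VectorMeasure.tendsto_integral_filter_of_norm_le_const
    (Eventually.of_forall fun n ↦ (hF n).aestronglyMeasurable)
    ⟨K, Eventually.of_forall fun n ↦ ?_⟩ ?_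
  · rw [VectorMeasure.variation_restrict hA]
    exact ae_restrict_of_forall_mem hA (hK n)
  · rw [VectorMeasure.variation_restrict hA]
    exact ae_restrict_of_forall_mem hA h

namespace IsRegularPath

variable {z y : ℝ} {V W : ℝ≥0} {f g : ℝ → ℝ}

lemma boundedVariationOn (hf : IsRegularPath z V f) : BoundedVariationOn f univ :=
  (hf.variation_le.trans_lt ENNReal.coe_lt_top).ne

lemma stieltjes_eq (hf : IsRegularPath z V f) :
    stieltjes f = hf.boundedVariationOn.vectorMeasure := by
  rw [stieltjes, dif_pos hf.boundedVariationOn]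

/-- `BoundedVariationOn.vectorMeasure` is computed from one-sided limits; right-continuity turns the
right limits into values. -/
lemma rightLim_eq (hf : IsRegularPath z V f) (t : ℝ) : Function.rightLim f t = f t :=
  rightLim_eq_of_tendsto
    ((hf.rightContinuous t).mono Ioi_subset_Ici_self).tendsto

lemma stieltjes_Ioc (hf : IsRegularPath z V f) {a b : ℝ} (hab : a ≤ b) :
    stieltjes f (Ioc a b) = f b - f a := by
  rw [hf.stieltjes_eq, BoundedVariationOn.vectorMeasure_Ioc _ hab, hf.rightLim_eq, hf.rightLim_eq]

lemma stieltjes_singleton (hf : IsRegularPath z V f) (t : ℝ) :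
    stieltjes f {t} = jump f t := by
  rw [hf.stieltjes_eq, BoundedVariationOn.vectorMeasure_singleton, hf.rightLim_eq, jump]

lemma leftLim_zero (hf : IsRegularPath z V f) : Function.leftLim f 0 = z := by
  refine leftLim_eq_of_tendsto (tendsto_const_nhds.congr' ?_)
  filter_upwards [self_mem_nhdsWithin] with t ht using (hf.initial t ht).symm

lemma stieltjes_cell (hf : IsRegularPath z V f) (hT : 0 < T) {n i : ℕ} (hi : i ≤ 2 ^ n) :
    stieltjes f (Icc 0 T ∩ cell T n ⁻¹' {i}) = increment T n f i := by
  rcases i with _ | i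
  · have : Icc 0 T ∩ cell T n ⁻¹' {0} = {0} := by
      ext s
      simp only [mem_inter_iff, mem_Icc, mem_preimage, mem_singleton_iff, cell_eq_zero_iff hT]
      constructor
      · rintro ⟨⟨h, -⟩, h'⟩; exact le_antisymm h' h
      · rintro rfl; simp [hT.le]
    rw [this, hf.stieltjes_singleton, jump, hf.leftLim_zero, increment,
      hf.initial _ (prevNode_zero_neg hT n)]
    simp [node]
  · have : Icc 0 T ∩ cell T n ⁻¹' {i + 1} = Ioc (node T n i) (node T n (i + 1)) := by
      ext s
      simp only [mem_inter_iff, mem_preimage, mem_singleton_iff, cell_eq_succ_iff hT,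
        and_iff_right_iff_imp]
      refine fun h ↦ ⟨(node_nonneg hT n i).trans h.1.le, h.2.trans ?_⟩
      exact (node_mono hT n hi).trans_eq (node_two_pow n)
    rw [this, hf.stieltjes_Ioc (node_mono hT n i.le_succ), increment, prevNode_succ]

/-- The Stieltjes integral of a function that is constant on the cells of a dyadic partition. -/
lemma setIntegral_comp_cell (hf : IsRegularPath z V f) (hT : 0 < T) (n : ℕ) (φ : ℕ → ℝ) :
    ∫ᵛ s in Icc 0 T, φ (cell T n s) ∂•(stieltjes f) =
      ∑ i ∈ Finset.range (2 ^ n + 1), φ i * increment T n f i := by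
  have hU : Icc 0 T = ⋃ i ∈ Finset.range (2 ^ n + 1), Icc 0 T ∩ cell T n ⁻¹' {i} := by
    ext s
    simp only [mem_iUnion, mem_inter_iff, mem_preimage, mem_singleton_iff, exists_prop,
      Finset.mem_range, Nat.lt_succ_iff]
    constructor
    · exact fun h ↦ ⟨_, cell_le_two_pow hT n h.2, h, rfl⟩
    · rintro ⟨i, -, h, -⟩; exact h
  have hm (i : ℕ) : MeasurableSet (Icc 0 T ∩ cell T n ⁻¹' {i}) :=
    measurableSet_Icc.inter (measurable_cell n (measurableSet_singleton i))
  have hEq (i : ℕ) : EqOn (fun s ↦ φ (cell T n s)) (fun _ ↦ φ i) (Icc 0 T ∩ cell T n ⁻¹' {i}) :=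
    fun s hs ↦ congrArg φ hs.2
  nth_rw 1 [hU]
  rw [VectorMeasure.setIntegral_biUnion_finset _ (fun i _ ↦ hm i)]
  · refine Finset.sum_congr rfl fun i hi ↦ ?_
    rw [VectorMeasure.setIntegral_congr_fun (hEq i), VectorMeasure.setIntegral_const,
      hf.stieltjes_cell hT (Nat.lt_succ_iff.1 (Finset.mem_range.1 hi))]
    simp
  · intro i _ j _ hij
    refine disjoint_left.2 fun s hs hs' ↦ hij ?_
    exact hs.2.symm.trans hs'.2
  · intro i _
    have : MeasureTheory.IntegrableOn (fun s ↦ φ (cell T n s)) (Icc 0 T ∩ cell T n ⁻¹' {i})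
        (stieltjes f).variation :=
      (integrableOn_const (C := φ i) (measure_ne_top _ _)).congr_fun (hEq i).symm (hm i)
    rw [VectorMeasure.IntegrableOn, VectorMeasure.Integrable, VectorMeasure.variation_restrict (hm i)]
    exact this

/-- The sequence `prevNode T n` is monotone and starts at a negative time, so the jump at `0` is
counted in the variation. -/
lemma sum_abs_increment_le (hf : IsRegularPath z V f) (hT : 0 < T) (n N : ℕ) :
    ∑ i ∈ Finset.range N, |increment T n f i| ≤ V := by
  have h := (eVariationOn.sum_le (f := f) (s := univ) (n := N) (u := prevNode T n)
    (monotone_nat_of_le_succ fun i ↦ by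
      rw [prevNode_succ]; exact (prevNode_lt_node hT n i).le) (fun _ ↦ mem_univ _)).trans
    hf.variation_le
  simp only [prevNode_succ, edist_dist, Real.dist_eq] at h
  rw [← ENNReal.ofReal_sum_of_nonneg (fun _ _ ↦ abs_nonneg _), ← ENNReal.ofReal_coe_nnreal] at h
  exact (ENNReal.ofReal_le_ofReal_iff V.2).1 h

end IsRegularPath

end

/-! ### Bilinear forms given by kernels, and the costs in terms of them. -/

section

/-- A bounded kernel whose values along the dyadic partitions of `[0, T]` converge pointwise. -/
structure IsDyadicKernel (T : ℝ) (k : ℝ → ℝ → ℝ) : Prop where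
  abs_le : ∀ t s, |k t s| ≤ 1
  tendsto : ∀ t s, 0 ≤ t → 0 ≤ s →
    Tendsto (fun n ↦ k (node T n (cell T n t)) (node T n (cell T n s))) atTop (𝓝 (k t s))

/-- The iterated Stieltjes integral `∫_{[0,T]} ∫_{[0,T]} k(t,s) dg_s df_t`. -/
def kernelForm (k : ℝ → ℝ → ℝ) (T : ℝ) (f g : ℝ → ℝ) : ℝ :=
  ∫ᵛ t in Icc 0 T, (∫ᵛ s in Icc 0 T, k t s ∂•(stieltjes g)) ∂•(stieltjes f)

/-- The Riemann sum of `kernelForm` along the dyadic partition of `[0, T]` of level `n`. -/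
def riemannSum (k : ℝ → ℝ → ℝ) (T : ℝ) (n : ℕ) (f g : ℝ → ℝ) : ℝ :=
  ∑ i ∈ Finset.range (2 ^ n + 1), (∑ j ∈ Finset.range (2 ^ n + 1),
    k (node T n i) (node T n j) * increment T n g j) * increment T n f i

def expKernel (ρ t s : ℝ) : ℝ := Real.exp (-ρ * |t - s|)

/-- The strict inequality reflects the integral over `[0, t)`; simultaneous jumps are left to
`diagKernel`. -/
def causalKernel (ρ t s : ℝ) : ℝ := if s < t then Real.exp (-ρ * (t - s)) else 0

def diagKernel (t s : ℝ) : ℝ := if s = t then 1 else 0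

variable {T ρ : ℝ}

lemma isDyadicKernel_expKernel (hT : 0 < T) (hρ : 0 < ρ) : IsDyadicKernel T (expKernel ρ) where
  abs_le t s := by
    rw [expKernel, abs_of_pos (Real.exp_pos _), Real.exp_le_one_iff]
    have : 0 ≤ ρ * |t - s| := by positivity
    linarith
  tendsto t s ht hs := by
    have h := ((tendsto_node_cell hT ht).sub (tendsto_node_cell hT hs)).abs.const_mul (-ρ)
    exact (Real.continuous_exp.tendsto _).comp h

/-- Discontinuity on the diagonal does no harm: equal times stay equal after rounding, and distinct
times are eventually rounded to distinct nodes in the same order. The causal kernel is treated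
alike. -/
lemma isDyadicKernel_diagKernel (hT : 0 < T) : IsDyadicKernel T diagKernel where
  abs_le t s := by unfold diagKernel; split_ifs <;> simp
  tendsto t s ht hs := by
    refine tendsto_const_nhds.congr' ?_
    rcases lt_trichotomy s t with h | rfl | h
    · filter_upwards [eventually_node_cell_lt hT hs h] with n hn
      simp [diagKernel, hn.ne, h.ne]
    · simp [diagKernel]
    · filter_upwards [eventually_node_cell_lt hT ht h] with n hn
      simp [diagKernel, hn.ne', h.ne']

lemma isDyadicKernel_causalKernel (hT : 0 < T) (hρ : 0 < ρ) :
    IsDyadicKernel T (causalKernel ρ) where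
  abs_le t s := by
    unfold causalKernel
    split_ifs with h
    · rw [abs_of_pos (Real.exp_pos _), Real.exp_le_one_iff]
      have : 0 < ρ * (t - s) := mul_pos hρ (sub_pos.2 h)
      linarith
    · simp
  tendsto t s ht hs := by
    rcases lt_trichotomy s t with h | rfl | h
    · have := (Real.continuous_exp.tendsto _).comp
        (((tendsto_node_cell hT ht).sub (tendsto_node_cell hT hs)).const_mul (-ρ))
      simp only [causalKernel, if_pos h]
      refine this.congr' ?_
      filter_upwards [eventually_node_cell_lt hT hs h] with n hn
      simp [hn]
    · simp [causalKernel]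
    · refine tendsto_const_nhds.congr' ?_
      filter_upwards [eventually_node_cell_lt hT ht h] with n hn
      simp [causalKernel, hn.not_gt, h.not_gt]

section kernelForm

variable {k : ℝ → ℝ → ℝ} {x y z : ℝ} {U V W : ℝ≥0} {f g h : ℝ → ℝ}

/-- A Riemann sum is the iterated integral of the kernel rounded to nodes. Dominated convergence
applies to the inner integral with bound `1`, then to the outer one with bound `V`. -/
lemma tendsto_riemannSum (hT : 0 < T) (hk : IsDyadicKernel T k) (hf : IsRegularPath x U f)
    (hg : IsRegularPath y V g) :
    Tendsto (fun n ↦ riemannSum k T n f g) atTop (𝓝 (kernelForm k T f g)) := by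
  have hsum (n i : ℕ) : |∑ j ∈ Finset.range (2 ^ n + 1),
      k (node T n i) (node T n j) * increment T n g j| ≤ V := by
    refine (Finset.abs_sum_le_sum_abs _ _).trans
      ((Finset.sum_le_sum fun j _ ↦ ?_).trans (hg.sum_abs_increment_le hT n (2 ^ n + 1)))
    rw [abs_mul]
    exact mul_le_of_le_one_left (abs_nonneg _) (hk.abs_le _ _)
  simp_rw [riemannSum]
  simp_rw [← fun n ↦ hf.setIntegral_comp_cell hT n (fun i ↦ ∑ j ∈ Finset.range (2 ^ n + 1),
    k (node T n i) (node T n j) * increment T n g j)]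
  refine tendsto_setIntegral_of_bounded measurableSet_Icc V (fun n ↦ ?_) (fun n t _ ↦ hsum n _)
    fun t ht ↦ ?_
  · exact (measurable_from_nat (f := fun i ↦ ∑ j ∈ Finset.range (2 ^ n + 1),
      k (node T n i) (node T n j) * increment T n g j)).comp (measurable_cell n)
  · simp_rw [← fun n ↦ hg.setIntegral_comp_cell hT n
      (fun j ↦ k (node T n (cell T n t)) (node T n j))]
    refine tendsto_setIntegral_of_bounded measurableSet_Icc 1 (fun n ↦ ?_)
      (fun n s _ ↦ hk.abs_le _ _) fun s hs ↦ hk.tendsto t s ht.1 hs.1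
    exact (measurable_from_nat (f := fun j ↦ k (node T n (cell T n t)) (node T n j))).comp
      (measurable_cell n)

lemma abs_riemannSum_le (hT : 0 < T) (hk : IsDyadicKernel T k) (hf : IsRegularPath x U f)
    (hg : IsRegularPath y V g) (n : ℕ) : |riemannSum k T n f g| ≤ V * U := by
  calc |riemannSum k T n f g|
    _ ≤ ∑ i ∈ Finset.range (2 ^ n + 1), V * |increment T n f i| := by
      refine (Finset.abs_sum_le_sum_abs _ _).trans (Finset.sum_le_sum fun i _ ↦ ?_)
      rw [abs_mul]
      refine mul_le_mul_of_nonneg_right ?_ (abs_nonneg _)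
      refine (Finset.abs_sum_le_sum_abs _ _).trans
        ((Finset.sum_le_sum fun j _ ↦ ?_).trans (hg.sum_abs_increment_le hT n (2 ^ n + 1)))
      rw [abs_mul]
      exact mul_le_of_le_one_left (abs_nonneg _) (hk.abs_le _ _)
    _ ≤ V * U := by
      rw [← Finset.mul_sum]
      exact mul_le_mul_of_nonneg_left (hf.sum_abs_increment_le hT n _) V.2

lemma abs_kernelForm_le (hT : 0 < T) (hk : IsDyadicKernel T k) (hf : IsRegularPath x U f)
    (hg : IsRegularPath y V g) : |kernelForm k T f g| ≤ V * U :=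
  le_of_tendsto' (tendsto_riemannSum hT hk hf hg).abs (abs_riemannSum_le hT hk hf hg)

lemma IsRegularPath.add_mul (hf : IsRegularPath x U f) (hg : IsRegularPath y V g) (c : ℝ) :
    IsRegularPath (x + c * y) (U + ‖c‖₊ * V) (fun t ↦ f t + c * g t) where
  variation_le := by
    refine iSup_le fun p ↦ ?_
    calc ∑ i ∈ Finset.range p.1, edist (f (p.2.1 (i + 1)) + c * g (p.2.1 (i + 1)))
          (f (p.2.1 i) + c * g (p.2.1 i))
      _ ≤ ∑ i ∈ Finset.range p.1, (edist (f (p.2.1 (i + 1))) (f (p.2.1 i)) +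
          ‖c‖₊ * edist (g (p.2.1 (i + 1))) (g (p.2.1 i))) := by
        refine Finset.sum_le_sum fun i _ ↦ (edist_add_add_le _ _ _ _).trans_eq ?_
        congr 1
        simp [edist_eq_enorm_sub, ← mul_sub, enorm_eq_nnnorm]
      _ ≤ eVariationOn f univ + ‖c‖₊ * eVariationOn g univ := by
        rw [Finset.sum_add_distrib, ← Finset.mul_sum]
        gcongr
        · exact eVariationOn.sum_le p.2.2.1 p.2.2.2
        · exact eVariationOn.sum_le p.2.2.1 p.2.2.2
      _ ≤ ((U + ‖c‖₊ * V : ℝ≥0) : ℝ≥0∞) := by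
        push_cast
        gcongr
        · exact hf.variation_le
        · exact hg.variation_le
  rightContinuous t := (hf.rightContinuous t).add ((hg.rightContinuous t).const_mul c)
  initial t ht := by simp [hf.initial t ht, hg.initial t ht]

lemma increment_add_mul (n i : ℕ) (c : ℝ) :
    increment T n (fun t ↦ f t + c * g t) i = increment T n f i + c * increment T n g i := by
  simp only [increment]; ring

/-- Increments are linear in the path, so the identity holds for each Riemann sum and survives the
limit. -/
lemma kernelForm_add_mul_left (hT : 0 < T) (hk : IsDyadicKernel T k) (hf : IsRegularPath x U f)
    (hg : IsRegularPath y V g) (hh : IsRegularPath z W h) (c : ℝ) :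
    kernelForm k T (fun t ↦ f t + c * g t) h = kernelForm k T f h + c * kernelForm k T g h := by
  refine tendsto_nhds_unique (tendsto_riemannSum hT hk (hf.add_mul hg c) hh)
    (((tendsto_riemannSum hT hk hf hh).add ((tendsto_riemannSum hT hk hg hh).const_mul c)).congr
      fun n ↦ ?_)
  simp only [riemannSum, increment_add_mul, Finset.mul_sum, ← Finset.sum_add_distrib]
  exact Finset.sum_congr rfl fun i _ ↦ by ring

lemma kernelForm_add_mul_right (hT : 0 < T) (hk : IsDyadicKernel T k) (hf : IsRegularPath x U f)
    (hg : IsRegularPath y V g) (hh : IsRegularPath z W h) (c : ℝ) :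
    kernelForm k T h (fun t ↦ f t + c * g t) = kernelForm k T h f + c * kernelForm k T h g := by
  refine tendsto_nhds_unique (tendsto_riemannSum hT hk hh (hf.add_mul hg c))
    (((tendsto_riemannSum hT hk hh hf).add ((tendsto_riemannSum hT hk hh hg).const_mul c)).congr
      fun n ↦ ?_)
  simp only [riemannSum, increment_add_mul, Finset.mul_sum, ← Finset.sum_add_distrib]
  refine Finset.sum_congr rfl fun i _ ↦ ?_
  rw [Finset.sum_mul, Finset.sum_mul, Finset.mul_sum, ← Finset.sum_add_distrib, Finset.sum_mul]
  exact Finset.sum_congr rfl fun j _ ↦ by ring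

lemma riemannSum_comm (hk : ∀ t s, k t s = k s t) (n : ℕ) :
    riemannSum k T n f g = riemannSum k T n g f := by
  simp only [riemannSum, Finset.sum_mul]
  rw [Finset.sum_comm]
  refine Finset.sum_congr rfl fun i _ ↦ Finset.sum_congr rfl fun j _ ↦ ?_
  rw [hk]; ring

/-- Exchanging two finite sums before the limit takes the place of Fubini. -/
lemma kernelForm_comm (hT : 0 < T) (hk : IsDyadicKernel T k) (hsymm : ∀ t s, k t s = k s t)
    (hf : IsRegularPath x U f) (hg : IsRegularPath y V g) :
    kernelForm k T f g = kernelForm k T g f :=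
  tendsto_nhds_unique (tendsto_riemannSum hT hk hf hg)
    ((tendsto_riemannSum hT hk hg hf).congr fun n ↦ riemannSum_comm (fun t s ↦ hsymm t s) n)

lemma expKernel_symm (ρ t s : ℝ) : expKernel ρ t s = expKernel ρ s t := by
  rw [expKernel, expKernel, abs_sub_comm]

lemma diagKernel_symm (t s : ℝ) : diagKernel t s = diagKernel s t := by
  simp [diagKernel, eq_comm]

lemma expKernel_eq_add (ρ t s : ℝ) :
    expKernel ρ t s = causalKernel ρ t s + causalKernel ρ s t + diagKernel t s := by
  rcases lt_trichotomy s t with h | rfl | h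
  · simp [expKernel, causalKernel, diagKernel, h, h.ne, h.le, abs_of_pos (sub_pos.2 h)]
  · simp [expKernel, causalKernel, diagKernel]
  · simp [expKernel, causalKernel, diagKernel, h, h.ne', h.le, abs_of_neg (sub_neg.2 h)]

/-- The two causal cross terms and the jump term add up to the symmetric exponential form. -/
lemma kernelForm_causal_add_causal (hT : 0 < T) (hρ : 0 < ρ) (hf : IsRegularPath x U f)
    (hg : IsRegularPath y V g) :
    kernelForm (causalKernel ρ) T f g + kernelForm (causalKernel ρ) T g f +
      kernelForm diagKernel T f g = kernelForm (expKernel ρ) T f g := by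
  refine tendsto_nhds_unique
    (((tendsto_riemannSum hT (isDyadicKernel_causalKernel hT hρ) hf hg).add
      (tendsto_riemannSum hT (isDyadicKernel_causalKernel hT hρ) hg hf)).add
      (tendsto_riemannSum hT (isDyadicKernel_diagKernel hT) hf hg))
    ((tendsto_riemannSum hT (isDyadicKernel_expKernel hT hρ) hf hg).congr fun n ↦ ?_)
  have : riemannSum (causalKernel ρ) T n g f =
      riemannSum (fun t s ↦ causalKernel ρ s t) T n f g := by
    simp only [riemannSum, Finset.sum_mul]
    rw [Finset.sum_comm]
    exact Finset.sum_congr rfl fun i _ ↦ Finset.sum_congr rfl fun j _ ↦ by ring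
  rw [this]
  simp only [riemannSum, expKernel_eq_add, ← Finset.sum_add_distrib, ← add_mul]

/-- Only diagonal terms survive, so each Riemann sum is a sum of squared increments. -/
lemma kernelForm_diag_self_nonneg (hT : 0 < T) (hf : IsRegularPath x U f) :
    0 ≤ kernelForm diagKernel T f f := by
  refine ge_of_tendsto' (tendsto_riemannSum hT (isDyadicKernel_diagKernel hT) hf hf) fun n ↦ ?_
  have hinj (i j : ℕ) : node T n j = node T n i ↔ j = i := by
    simp [node, hT.ne']
  refine Finset.sum_nonneg fun i hi ↦ ?_
  simp only [diagKernel, hinj, ite_mul, one_mul, zero_mul, Finset.sum_ite_eq', if_pos hi]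
  exact mul_self_nonneg _

end kernelForm

section cost

variable {x y : ℝ} {U V : ℝ≥0} {f g : ℝ → ℝ}

/-- Jump times are atoms of a finite measure. -/
lemma countable_jump_ne_zero (hg : IsRegularPath y V g) : {t | jump g t ≠ 0}.Countable := by
  refine (Measure.countable_meas_level_set_pos (μ := (stieltjes g).variation)
    measurable_id).mono fun t ht ↦ ?_
  simp only [mem_ofPred_eq, id] at ht ⊢
  have h := VectorMeasure.enorm_measure_le_variation (stieltjes g) {t}
  rw [hg.stieltjes_singleton] at h
  exact (enorm_pos.2 ht).trans_le h

/-- The inner integral picks out the atom of `dg` at `t`. The resulting integrand lives on a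
countable set, where the outer integral is a sum over atoms of `df`. -/
lemma kernelForm_diagKernel (hf : IsRegularPath x U f) (hg : IsRegularPath y V g) :
    kernelForm diagKernel T f g = ∑' t : Icc (0 : ℝ) T, jump f t * jump g t := by
  have h1 : kernelForm diagKernel T f g = ∫ᵛ t in Icc 0 T, jump g t ∂•(stieltjes f) := by
    refine VectorMeasure.setIntegral_congr_fun fun t ht ↦ ?_
    have : diagKernel t = ({t} : Set ℝ).indicator fun _ ↦ (1 : ℝ) := by
      ext s; simp [diagKernel, indicator_apply]
    rw [this]
    show (∫ᵛ s in Icc 0 T, ({t} : Set ℝ).indicator (fun _ ↦ (1 : ℝ)) s ∂•(stieltjes g)) = _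
    rw [VectorMeasure.setIntegral_indicator measurableSet_Icc
      (measurableSet_singleton t), inter_eq_self_of_subset_right (singleton_subset_iff.2 ht),
      VectorMeasure.integral_singleton, hg.stieltjes_singleton]
    simp
  set D : Set ℝ := Icc 0 T ∩ {t | jump g t ≠ 0} with hD
  have hDc : D.Countable := (countable_jump_ne_zero hg).mono inter_subset_right
  have hmeas : Measurable (jump g) := by
    refine (measurable_const (a := (0 : ℝ))).measurable_of_countable_ne ?_
    simpa [eq_comm] using countable_jump_ne_zero hg
  have hint : (stieltjes f).Integrable (jump g) := by
    refine Integrable.of_bound (C := (stieltjes g).variation.real univ)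
      hmeas.aestronglyMeasurable (Eventually.of_forall fun t ↦ ?_)
    rw [← hg.stieltjes_singleton]
    exact (VectorMeasure.norm_measure_le_variation (measure_ne_top _ _)).trans
      (measureReal_mono (subset_univ _))
  rw [h1, VectorMeasure.setIntegral_eq_of_subset_of_forall_sdiff_eq_zero hDc.measurableSet
    measurableSet_Icc inter_subset_left (fun t ht ↦ by grind)]
  have : Countable D := hDc.to_subtype
  have hU : D = ⋃ d : D, {(d : ℝ)} := by simp
  rw [hU, VectorMeasure.integral_iUnion (fun d ↦ measurableSet_singleton _)
    (fun a b hab ↦ by simpa [Function.onFun, Subtype.ext_iff] using hab) hint.integrableOn]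
  simp only [VectorMeasure.integral_singleton, hf.stieltjes_singleton,
    ContinuousLinearMap.lsmul_apply, smul_eq_mul]
  rw [tsum_subtype D (fun t ↦ jump g t * jump f t),
    tsum_subtype (Icc 0 T) (fun t ↦ jump f t * jump g t)]
  refine tsum_congr fun t ↦ ?_
  simp only [indicator_apply, hD]
  grind

/-- The liquidation costs expressed through iterated Stieltjes integrals. -/
lemma cost_eq (θ : ℝ) (hf : IsRegularPath x U f) (hg : IsRegularPath y V g) :
    cost ρ θ T f g = 1 / 2 * kernelForm (expKernel ρ) T f f + kernelForm (causalKernel ρ) T f g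
      + 1 / 2 * kernelForm diagKernel T f g + θ * kernelForm diagKernel T f f := by
  have hcausal : (∫ᵛ t in Icc 0 T, (∫ᵛ s in Ico 0 t, Real.exp (-ρ * (t - s)) ∂•(stieltjes g))
      ∂•(stieltjes f)) = kernelForm (causalKernel ρ) T f g := by
    refine VectorMeasure.setIntegral_congr_fun fun t ht ↦ ?_
    have h1 : causalKernel ρ t = (Iio t).indicator fun s ↦ Real.exp (-ρ * (t - s)) := by
      ext s; simp [causalKernel, indicator_apply]
    have h2 : Icc 0 T ∩ Iio t = Ico 0 t := by
      ext s; simp only [mem_inter_iff, mem_Icc, mem_Iio, mem_Ico] at ht ⊢; grind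
    show _ = ∫ᵛ s in Icc 0 T, causalKernel ρ t s ∂•(stieltjes g)
    rw [h1, VectorMeasure.setIntegral_indicator measurableSet_Icc measurableSet_Iio, h2]
  rw [cost, hcausal, kernelForm_diagKernel hf hg, kernelForm_diagKernel hf hf]
  simp only [pow_two]
  rfl

end cost

end

/-! ### Strict positive definiteness of the exponential form. -/

section

/-- The exponentially decaying response at time `u` to a unit impulse at time `p`. -/
def impulse (ρ p u : ℝ) : ℝ := (Ioi p).indicator (fun u ↦ Real.exp (-ρ * (u - p))) u

variable {T ρ z : ℝ} {V : ℝ≥0} {f : ℝ → ℝ}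

lemma measurable_impulse (p : ℝ) : Measurable (impulse ρ p) :=
  Measurable.indicator (by fun_prop) measurableSet_Ioi

lemma impulse_mul_impulse (p q : ℝ) : (fun u ↦ impulse ρ p u * impulse ρ q u) =
    (Ioi (max p q)).indicator fun u ↦ Real.exp (ρ * (p + q)) * Real.exp (-(2 * ρ) * u) := by
  ext u
  simp only [impulse, indicator_apply, mem_Ioi, max_lt_iff]
  by_cases hp : p < u <;> by_cases hq : q < u <;> simp [hp, hq, ← Real.exp_add]
  ring

lemma integrable_impulse_mul_impulse (hρ : 0 < ρ) (p q : ℝ) :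
    Integrable fun u ↦ impulse ρ p u * impulse ρ q u := by
  rw [impulse_mul_impulse, integrable_indicator_iff measurableSet_Ioi]
  exact (integrableOn_exp_mul_Ioi (by linarith) _).const_mul _

/-- The product of two impulses is an exponential of rate `2ρ` on `(max p q, ∞)`. This Gram
representation turns the quadratic form into an `L²` norm. -/
lemma expKernel_eq_integral (hρ : 0 < ρ) (p q : ℝ) :
    expKernel ρ p q = 2 * ρ * ∫ u, impulse ρ p u * impulse ρ q u := by
  rw [impulse_mul_impulse, integral_indicator measurableSet_Ioi, integral_const_mul,
    integral_exp_mul_Ioi (by linarith), neg_div_neg_eq, expKernel]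
  field_simp
  rw [← Real.exp_add]
  congr 1
  rcases le_total p q with h | h
  · rw [max_eq_right h, abs_of_nonpos (sub_nonpos.2 h)]; ring
  · rw [max_eq_left h, abs_of_nonneg (sub_nonneg.2 h)]; ring

/-- The response at time `u` to the increments of `f` along the dyadic partition of level `n`. -/
def dyadicResponse (ρ T : ℝ) (f : ℝ → ℝ) (n : ℕ) (u : ℝ) : ℝ :=
  ∑ i ∈ Finset.range (2 ^ n + 1), impulse ρ (prevNode T n i) u * increment T n f i

lemma measurable_dyadicResponse (n : ℕ) : Measurable (dyadicResponse ρ T f n) :=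
  Finset.measurable_fun_sum _ fun _ _ ↦ (measurable_impulse _).mul_const _

lemma dyadicResponse_sq (n : ℕ) (u : ℝ) : dyadicResponse ρ T f n u ^ 2 =
    ∑ i ∈ Finset.range (2 ^ n + 1), ∑ j ∈ Finset.range (2 ^ n + 1),
      increment T n f j * increment T n f i *
        (impulse ρ (prevNode T n i) u * impulse ρ (prevNode T n j) u) := by
  rw [dyadicResponse, pow_two, Finset.sum_mul_sum]
  exact Finset.sum_congr rfl fun i _ ↦ Finset.sum_congr rfl fun j _ ↦ by ring

lemma integrable_dyadicResponse_sq (hρ : 0 < ρ) (n : ℕ) :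
    Integrable fun u ↦ dyadicResponse ρ T f n u ^ 2 := by
  simp_rw [dyadicResponse_sq]
  exact integrable_finsetSum _ fun i _ ↦ integrable_finsetSum _ fun j _ ↦
    (integrable_impulse_mul_impulse hρ _ _).const_mul _

lemma riemannSum_expKernel_self (hρ : 0 < ρ) (n : ℕ) :
    riemannSum (expKernel ρ) T n f f = 2 * ρ * ∫ u, dyadicResponse ρ T f n u ^ 2 := by
  have hi (i j : ℕ) : Integrable fun u ↦ increment T n f j * increment T n f i *
      (impulse ρ (prevNode T n i) u * impulse ρ (prevNode T n j) u) :=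
    (integrable_impulse_mul_impulse hρ _ _).const_mul _
  -- Translation invariance of the kernel allows shifting both nodes to the left ends of their
  -- cells, where `dyadicResponse` places its impulses.
  have hk (i j : ℕ) : expKernel ρ (node T n i) (node T n j) =
      expKernel ρ (prevNode T n i) (prevNode T n j) := by
    simp only [expKernel, node, prevNode]
    congr 3; ring
  simp_rw [dyadicResponse_sq]
  rw [integral_finsetSum _ fun i _ ↦ integrable_finsetSum _ fun j _ ↦ hi i j, Finset.mul_sum]
  refine Finset.sum_congr rfl fun i _ ↦ ?_
  rw [integral_finsetSum _ fun j _ ↦ hi i j, Finset.mul_sum, Finset.sum_mul]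
  refine Finset.sum_congr rfl fun j _ ↦ ?_
  rw [hk, expKernel_eq_integral hρ, integral_const_mul]
  ring

lemma kernelForm_exp_self_nonneg (hT : 0 < T) (hρ : 0 < ρ) (hf : IsRegularPath z V f) :
    0 ≤ kernelForm (expKernel ρ) T f f := by
  refine ge_of_tendsto' (tendsto_riemannSum hT (isDyadicKernel_expKernel hT hρ) hf hf) fun n ↦ ?_
  rw [riemannSum_expKernel_self hρ]
  have : 0 ≤ ∫ u, dyadicResponse ρ T f n u ^ 2 := integral_nonneg fun u ↦ sq_nonneg _
  positivity

/-- An impulse starting at the left end of the cell of `s` starts strictly before `s`, hence is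
already active at `u = s`; this is why the limit involves the closed half-line `Iic u`. -/
lemma tendsto_dyadicResponse (hT : 0 < T) (hρ : 0 < ρ) (hf : IsRegularPath z V f) (u : ℝ) :
    Tendsto (fun n ↦ dyadicResponse ρ T f n u) atTop
      (𝓝 (∫ᵛ s in Icc 0 T, (Iic u).indicator (fun s ↦ Real.exp (-ρ * (u - s))) s
        ∂•(stieltjes f))) := by
  simp_rw [dyadicResponse, ← fun n ↦ hf.setIntegral_comp_cell hT n
    (fun i ↦ impulse ρ (prevNode T n i) u)]
  refine tendsto_setIntegral_of_bounded measurableSet_Icc 1 (fun n ↦ ?_) (fun n s hs ↦ ?_)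
    fun s hs ↦ ?_
  · exact (measurable_from_nat (f := fun i ↦ impulse ρ (prevNode T n i) u)).comp
      (measurable_cell n)
  · simp only [impulse, indicator_apply, mem_Ioi]
    split_ifs with h
    · rw [abs_of_pos (Real.exp_pos _), Real.exp_le_one_iff]
      have := mul_pos hρ (sub_pos.2 h)
      linarith
    · simp
  · have hlim := tendsto_prevNode_cell hT hs.1
    by_cases hu : s ≤ u
    · rw [indicator_of_mem (mem_Iic.2 hu)]
      refine ((Real.continuous_exp.tendsto _).comp
        ((hlim.const_sub u).const_mul (-ρ))).congr fun n ↦ ?_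
      rw [impulse, indicator_of_mem (mem_Ioi.2 ((prevNode_cell_lt hT n hs.1).trans_le hu))]
      rfl
    · rw [indicator_of_notMem (by simpa using hu)]
      refine tendsto_const_nhds.congr' ?_
      filter_upwards [hlim.eventually_const_lt (not_le.1 hu)] with n hn
      rw [impulse, indicator_of_notMem (by simpa using hn.le)]

/-- The squared `L²` norms of the dyadic responses tend to `0`, so by Fatou their pointwise limit
has norm `0`. -/
lemma ae_response_eq_zero (hT : 0 < T) (hρ : 0 < ρ) (hf : IsRegularPath z V f)
    (h0 : kernelForm (expKernel ρ) T f f = 0) :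
    ∀ᵐ u : ℝ, ∫ᵛ s in Icc 0 T, (Iic u).indicator (fun s ↦ Real.exp (-ρ * (u - s))) s
        ∂•(stieltjes f) = 0 := by
  set J : ℝ → ℝ := fun u ↦ ∫ᵛ s in Icc 0 T, (Iic u).indicator (fun s ↦ Real.exp (-ρ * (u - s))) s
        ∂•(stieltjes f)
  have hJ (u : ℝ) : Tendsto (fun n ↦ dyadicResponse ρ T f n u) atTop (𝓝 (J u)) :=
    tendsto_dyadicResponse hT hρ hf u
  have hJm : Measurable J :=
    measurable_of_tendsto_metrizable (fun n ↦ measurable_dyadicResponse n) (tendsto_pi_nhds.2 hJ)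
  have hlim : Tendsto (fun n ↦ ∫⁻ u, ENNReal.ofReal (dyadicResponse ρ T f n u ^ 2)) atTop
      (𝓝 0) := by
    have := (tendsto_riemannSum hT (isDyadicKernel_expKernel hT hρ) hf hf).const_mul (2 * ρ)⁻¹
    rw [h0, mul_zero] at this
    have := ENNReal.tendsto_ofReal this
    rw [ENNReal.ofReal_zero] at this
    refine this.congr fun n ↦ ?_
    rw [← ofReal_integral_eq_lintegral_ofReal (integrable_dyadicResponse_sq hρ n)
      (Eventually.of_forall fun u ↦ sq_nonneg _), riemannSum_expKernel_self hρ]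
    congr 1
    field_simp
  have hle : ∫⁻ u, ENNReal.ofReal (J u ^ 2) ≤ 0 := by
    calc ∫⁻ u, ENNReal.ofReal (J u ^ 2)
      _ = ∫⁻ u, liminf (fun n ↦ ENNReal.ofReal (dyadicResponse ρ T f n u ^ 2)) atTop :=
        lintegral_congr fun u ↦ (ENNReal.tendsto_ofReal ((hJ u).pow 2)).liminf_eq.symm
      _ ≤ liminf (fun n ↦ ∫⁻ u, ENNReal.ofReal (dyadicResponse ρ T f n u ^ 2)) atTop :=
        lintegral_liminf_le fun n ↦ ((measurable_dyadicResponse n).pow_const 2).ennreal_ofReal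
      _ = 0 := hlim.liminf_eq
  have := (lintegral_eq_zero_iff (hJm.pow_const 2).ennreal_ofReal).1 (le_antisymm hle bot_le)
  filter_upwards [this] with u hu
  have : J u ^ 2 ≤ 0 := by simpa using hu
  exact pow_eq_zero_iff two_ne_zero |>.1 (le_antisymm this (sq_nonneg _))

lemma setIntegral_exp_eq_zero (hT : 0 < T) (hρ : 0 < ρ) (hf : IsRegularPath z V f)
    (h0 : kernelForm (expKernel ρ) T f f = 0) (u : ℝ) :
    ∫ᵛ s in Icc 0 T, (Iic u).indicator (fun s ↦ Real.exp (ρ * s)) s ∂•(stieltjes f) = 0 := by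
  have hae : ∀ᵐ u : ℝ, ∫ᵛ s in Icc 0 T, (Iic u).indicator (fun s ↦ Real.exp (ρ * s)) s
      ∂•(stieltjes f) = 0 := by
    filter_upwards [ae_response_eq_zero hT hρ hf h0] with u hu
    have h1 : (Iic u).indicator (fun s ↦ Real.exp (-ρ * (u - s))) =
        fun s ↦ Real.exp (-ρ * u) • (Iic u).indicator (fun s ↦ Real.exp (ρ * s)) s := by
      ext s
      by_cases hs : s ≤ u <;> simp [hs, ← Real.exp_add]
      ring
    rw [h1, VectorMeasure.integral_fun_smul] at hu
    exact (smul_eq_zero.1 hu).resolve_left (Real.exp_pos _).ne'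
  -- The exceptional null set is removed by approaching `u` strictly from the right, where the
  -- indicators of `Iic (v n)` converge everywhere to that of `Iic u`.
  have hd := Measure.dense_of_ae hae
  choose v hv using fun n : ℕ ↦ hd.exists_between
    (show u < u + 1 / ((n : ℝ) + 1) by simp; positivity)
  have hvu : Tendsto v atTop (𝓝 u) :=
    tendsto_of_tendsto_of_tendsto_of_le_of_le tendsto_const_nhds
      (by simpa using tendsto_const_nhds.add (tendsto_one_div_add_atTop_nhds_zero_nat (𝕜 := ℝ)))
      (fun n ↦ (hv n).2.1.le) (fun n ↦ (hv n).2.2.le)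
  have hlim := tendsto_setIntegral_of_bounded (μ := stieltjes f) (A := Icc 0 T) measurableSet_Icc
    (F := fun n s ↦ (Iic (v n)).indicator (fun s ↦ Real.exp (ρ * s)) s)
    (f := fun s ↦ (Iic u).indicator (fun s ↦ Real.exp (ρ * s)) s) (Real.exp (ρ * T))
    (fun n ↦ Measurable.indicator (by fun_prop) measurableSet_Iic)
    (fun n s hs ↦ by
      simp only [indicator_apply, mem_Iic]
      split_ifs
      · rw [abs_of_pos (Real.exp_pos _)]
        gcongr
        exact hs.2
      · simpa using (Real.exp_pos _).le)
    (fun s hs ↦ by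
      refine tendsto_const_nhds.congr' ?_
      by_cases hsu : s ≤ u
      · exact Eventually.of_forall fun n ↦ by simp [hsu, hsu.trans (hv n).2.1.le]
      · filter_upwards [hvu.eventually_lt_const (not_le.1 hsu)] with n hn
        simp [hsu, hn])
  exact tendsto_nhds_unique hlim (tendsto_const_nhds.congr fun n ↦ (hv n).1.symm)

/-- The exponential form is strictly positive definite. -/
lemma eq_of_kernelForm_exp_self_eq_zero (hT : 0 < T) (hρ : 0 < ρ) (hf : IsRegularPath z V f)
    (h0 : kernelForm (expKernel ρ) T f f = 0) {u : ℝ} (hu : u ∈ Icc 0 T) : f u = z := by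
  set μ : SignedMeasure ℝ := (stieltjes f).restrict (Icc 0 T) with hμ
  have hint : μ.Integrable fun s ↦ Real.exp (ρ * s) := by
    refine Integrable.of_bound (C := Real.exp (ρ * T)) (by fun_prop) ?_
    rw [hμ, VectorMeasure.variation_restrict measurableSet_Icc]
    refine ae_restrict_of_forall_mem measurableSet_Icc fun s hs ↦ ?_
    rw [Real.norm_of_nonneg (Real.exp_pos _).le]
    gcongr
    exact hs.2
  have hIic (v : ℝ) :
      μ.withDensity (fun s ↦ Real.exp (ρ * s)) (ContinuousLinearMap.lsmul ℝ ℝ) (Iic v) = 0 := by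
    rw [VectorMeasure.withDensity_apply hint, ← VectorMeasure.integral_indicator measurableSet_Iic]
    exact setIntegral_exp_eq_zero hT hρ hf h0 v
  -- Closed half-lines form a generating π-system; the total mass is checked separately and equals
  -- that of `Iic T`, since `μ` lives on `[0, T]`.
  have hν : μ.withDensity (fun s ↦ Real.exp (ρ * s)) (ContinuousLinearMap.lsmul ℝ ℝ) = 0 := by
    refine VectorMeasure.ext_of_generateFrom (range Iic) ?_
      ((BorelSpace.measurable_eq (α := ℝ)).trans (borel_eq_generateFrom_Iic ℝ)) isPiSystem_Iic ?_
    · rintro _ ⟨v, rfl⟩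
      exact hIic v
    · rw [VectorMeasure.withDensity_apply_univ]
      show _ = (0 : ℝ)
      rw [← setIntegral_exp_eq_zero hT hρ hf h0 T]
      refine VectorMeasure.setIntegral_congr_fun fun s hs ↦ ?_
      exact (indicator_of_mem (s := Iic T) hs.2 fun s ↦ Real.exp (ρ * s)).symm
  -- The density never vanishes, so it can be divided out.
  have hvar : μ.variation = 0 := by
    have h := VectorMeasure.variation_withDensity (B := ContinuousLinearMap.lsmul ℝ ℝ) hint
      (fun x y ↦ by simp [nnnorm_mul])
    rw [hν, VectorMeasure.variation_zero, VectorMeasure.variation_transpose_lsmul] at h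
    have h' := (withDensity_eq_zero_iff (by fun_prop)).1 h.symm
    rw [← ae_eq_bot, ← empty_mem_iff_bot]
    filter_upwards [h'] with s hs
    simp [(Real.exp_pos _).ne'] at hs
  have hzero : stieltjes f (Icc 0 u) = 0 := by
    have h := VectorMeasure.enorm_measure_le_variation μ (Icc 0 u)
    rw [hvar, hμ, VectorMeasure.restrict_apply _ measurableSet_Icc measurableSet_Icc,
      inter_eq_self_of_subset_left (Icc_subset_Icc_right hu.2)] at h
    simpa using h
  rw [hf.stieltjes_eq, BoundedVariationOn.vectorMeasure_Icc _ hu.1, hf.rightLim_eq,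
    hf.leftLim_zero] at hzero
  linarith

end

/-! ### Expected costs and first-order conditions. -/

section

variable {Ω : Type*} {m : MeasurableSpace Ω} {P : Measure Ω} {T ρ θ : ℝ}

/-- The costs of perturbed paths depend quadratically on the sizes of the perturbations. -/
lemma cost_add_mul {x y a b : ℝ} {U V U' V' : ℝ≥0} {f g p q : ℝ → ℝ} (hT : 0 < T) (hρ : 0 < ρ)
    (hf : IsRegularPath x U f) (hg : IsRegularPath y V g) (hp : IsRegularPath a U' p)
    (hq : IsRegularPath b V' q) (α β : ℝ) :
    cost ρ θ T (fun t ↦ f t + α * p t) (fun t ↦ g t + β * q t) =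
      cost ρ θ T f g
        + α * (kernelForm (expKernel ρ) T f p + kernelForm (causalKernel ρ) T p g
          + 1 / 2 * kernelForm diagKernel T p g + 2 * θ * kernelForm diagKernel T f p)
        + β * (kernelForm (causalKernel ρ) T f q + 1 / 2 * kernelForm diagKernel T f q)
        + α ^ 2 * (1 / 2 * kernelForm (expKernel ρ) T p p + θ * kernelForm diagKernel T p p)
        + α * β * (kernelForm (causalKernel ρ) T p q + 1 / 2 * kernelForm diagKernel T p q) := by
  have hE := isDyadicKernel_expKernel hT hρ
  have hC := isDyadicKernel_causalKernel hT hρ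
  have hD := isDyadicKernel_diagKernel hT
  have hfp := hf.add_mul hp α
  have hgq := hg.add_mul hq β
  rw [cost_eq θ hfp hgq, cost_eq θ hf hg,
    kernelForm_add_mul_left hT hE hf hp hfp, kernelForm_add_mul_right hT hE hf hp hf,
    kernelForm_add_mul_right hT hE hf hp hp,
    kernelForm_add_mul_left hT hC hf hp hgq, kernelForm_add_mul_right hT hC hg hq hf,
    kernelForm_add_mul_right hT hC hg hq hp,
    kernelForm_add_mul_left hT hD hf hp hgq, kernelForm_add_mul_right hT hD hg hq hf,
    kernelForm_add_mul_right hT hD hg hq hp,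
    kernelForm_add_mul_left hT hD hf hp hfp, kernelForm_add_mul_right hT hD hf hp hf,
    kernelForm_add_mul_right hT hD hf hp hp,
    kernelForm_comm hT hE (expKernel_symm ρ) hp hf, kernelForm_comm hT hD diagKernel_symm hp hf]
  ring

/-- A measurable random path that is almost surely regular with deterministic bounds. -/
structure IsRegularRandomPath (P : Measure Ω) (z : ℝ) (V : ℝ≥0) (F : Ω → ℝ → ℝ) : Prop where
  measurable : ∀ t, Measurable fun ω ↦ F ω t
  ae_regular : ∀ᵐ ω ∂P, IsRegularPath z V (F ω)

variable {x y a b : ℝ} {U V U' V' : ℝ≥0} {F G p q : Ω → ℝ → ℝ}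

lemma IsRegularRandomPath.add_mul (hF : IsRegularRandomPath P x U F) (hG : IsRegularRandomPath P y V G)
    (c : ℝ) : IsRegularRandomPath P (x + c * y) (U + ‖c‖₊ * V) (fun ω t ↦ F ω t + c * G ω t) where
  measurable t := (hF.measurable t).add ((hG.measurable t).const_mul c)
  ae_regular := by
    filter_upwards [hF.ae_regular, hG.ae_regular] with ω h h' using h.add_mul h' c

/-- Each Riemann sum involves the paths at finitely many times, hence is measurable in `ω`; the
limit inherits this and the deterministic bound. -/
lemma integrable_kernelForm [IsFiniteMeasure P] {k : ℝ → ℝ → ℝ} (hT : 0 < T)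
    (hk : IsDyadicKernel T k) (hF : IsRegularRandomPath P x U F) (hG : IsRegularRandomPath P y V G) :
    Integrable (fun ω ↦ kernelForm k T (F ω) (G ω)) P := by
  have hmeas (n : ℕ) : Measurable fun ω ↦ riemannSum k T n (F ω) (G ω) := by
    refine Finset.measurable_fun_sum _ fun i _ ↦ Measurable.mul
      (Finset.measurable_fun_sum _ fun j _ ↦ Measurable.const_mul ?_ _) ?_
    · exact (hG.measurable _).sub (hG.measurable _)
    · exact (hF.measurable _).sub (hF.measurable _)
  refine Integrable.of_bound (C := V * U) (aestronglyMeasurable_of_tendsto_ae atTop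
    (fun n ↦ (hmeas n).aestronglyMeasurable) ?_) ?_
  · filter_upwards [hF.ae_regular, hG.ae_regular] with ω h h' using tendsto_riemannSum hT hk h h'
  · filter_upwards [hF.ae_regular, hG.ae_regular] with ω h h' using abs_kernelForm_le hT hk h h'

lemma integrable_cost [IsFiniteMeasure P] (hT : 0 < T) (hρ : 0 < ρ)
    (hF : IsRegularRandomPath P x U F) (hG : IsRegularRandomPath P y V G) :
    Integrable (fun ω ↦ cost ρ θ T (F ω) (G ω)) P := by
  have hE := isDyadicKernel_expKernel hT hρ
  have hC := isDyadicKernel_causalKernel hT hρ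
  have hD := isDyadicKernel_diagKernel hT
  refine (((((integrable_kernelForm hT hE hF hF).const_mul (1 / 2)).add
    (integrable_kernelForm hT hC hF hG)).add
    ((integrable_kernelForm hT hD hF hG).const_mul (1 / 2))).add
    ((integrable_kernelForm hT hD hF hF).const_mul θ)).congr ?_
  filter_upwards [hF.ae_regular, hG.ae_regular] with ω h h'
  exact (cost_eq θ h h').symm

/-- The mixed second-order coefficient of the expected costs. -/
def crossTerm (ρ T : ℝ) (p q : ℝ → ℝ) : ℝ :=
  kernelForm (causalKernel ρ) T p q + 1 / 2 * kernelForm diagKernel T p q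

/-- The pure second-order coefficient of the expected costs. -/
def squareTerm (ρ θ T : ℝ) (p : ℝ → ℝ) : ℝ :=
  1 / 2 * kernelForm (expKernel ρ) T p p + θ * kernelForm diagKernel T p p

lemma integrable_crossTerm [IsFiniteMeasure P] (hT : 0 < T) (hρ : 0 < ρ)
    (hp : IsRegularRandomPath P a U p) (hq : IsRegularRandomPath P b V q) :
    Integrable (fun ω ↦ crossTerm ρ T (p ω) (q ω)) P :=
  (integrable_kernelForm hT (isDyadicKernel_causalKernel hT hρ) hp hq).add
    ((integrable_kernelForm hT (isDyadicKernel_diagKernel hT) hp hq).const_mul _)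

lemma integrable_squareTerm [IsFiniteMeasure P] (hT : 0 < T) (hρ : 0 < ρ)
    (hp : IsRegularRandomPath P a U p) : Integrable (fun ω ↦ squareTerm ρ θ T (p ω)) P :=
  ((integrable_kernelForm hT (isDyadicKernel_expKernel hT hρ) hp hp).const_mul _).add
    ((integrable_kernelForm hT (isDyadicKernel_diagKernel hT) hp hp).const_mul _)

/-- The costs are affine in the opponent's path, hence no `β²` term. `A`, `B`, `C` stay anonymous
because the first-order conditions eliminate them. -/
lemma integral_cost_add_mul [IsFiniteMeasure P] (hT : 0 < T) (hρ : 0 < ρ)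
    (hF : IsRegularRandomPath P x U F) (hG : IsRegularRandomPath P y V G)
    (hp : IsRegularRandomPath P a U' p) (hq : IsRegularRandomPath P b V' q) :
    ∃ A B C : ℝ, ∀ α β : ℝ,
      ∫ ω, cost ρ θ T (fun t ↦ F ω t + α * p ω t) (fun t ↦ G ω t + β * q ω t) ∂P =
        A + α * B + β * C + α ^ 2 * ∫ ω, squareTerm ρ θ T (p ω) ∂P
          + α * β * ∫ ω, crossTerm ρ T (p ω) (q ω) ∂P := by
  have hE := isDyadicKernel_expKernel hT hρ
  have hC := isDyadicKernel_causalKernel hT hρ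
  have hD := isDyadicKernel_diagKernel hT
  let B : Ω → ℝ := fun ω ↦ kernelForm (expKernel ρ) T (F ω) (p ω)
    + kernelForm (causalKernel ρ) T (p ω) (G ω) + 1 / 2 * kernelForm diagKernel T (p ω) (G ω)
    + 2 * θ * kernelForm diagKernel T (F ω) (p ω)
  have hB : Integrable B P :=
    (((integrable_kernelForm hT hE hF hp).add (integrable_kernelForm hT hC hp hG)).add
      ((integrable_kernelForm hT hD hp hG).const_mul _)).add
      ((integrable_kernelForm hT hD hF hp).const_mul _)
  refine ⟨∫ ω, cost ρ θ T (F ω) (G ω) ∂P, ∫ ω, B ω ∂P,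
    ∫ ω, crossTerm ρ T (F ω) (q ω) ∂P, fun α β ↦ ?_⟩
  have hA := integrable_cost (θ := θ) hT hρ hF hG
  have hFq := integrable_crossTerm hT hρ hF hq
  have hpq := integrable_crossTerm hT hρ hp hq
  have hpp := integrable_squareTerm (θ := θ) hT hρ hp
  rw [← integral_const_mul, ← integral_const_mul, ← integral_const_mul, ← integral_const_mul,
    ← integral_add' hA (hB.const_mul α), ← integral_add' (hA.add (hB.const_mul α)) (hFq.const_mul β),
    ← integral_add' ((hA.add (hB.const_mul α)).add (hFq.const_mul β)) (hpp.const_mul _),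
    ← integral_add' (((hA.add (hB.const_mul α)).add (hFq.const_mul β)).add (hpp.const_mul _))
      (hpq.const_mul _)]
  refine integral_congr_ae ?_
  filter_upwards [hF.ae_regular, hG.ae_regular, hp.ae_regular, hq.ae_regular] with ω h1 h2 h3 h4
  exact cost_add_mul hT hρ h1 h2 h3 h4 α β

lemma eq_zero_of_forall_quadratic_nonneg {b c : ℝ} (h : ∀ α : ℝ, 0 ≤ α * b + α ^ 2 * c) :
    b = 0 := by
  have h1 (α : ℝ) : 0 ≤ c * (α * α) + b * α + 0 := by linarith [h α]
  have := discrim_le_zero h1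
  simp only [discrim, mul_zero, sub_zero] at this
  exact pow_eq_zero_iff two_ne_zero |>.1 (le_antisymm this (sq_nonneg b))

/-- First-order conditions at two optimal positions, the second of which is a perturbation of the
first one, eliminate all terms but those of second order. -/
lemma integral_second_order_eq_zero [IsFiniteMeasure P] (hT : 0 < T) (hρ : 0 < ρ)
    (hF : IsRegularRandomPath P x U F) (hG : IsRegularRandomPath P y V G)
    (hp : IsRegularRandomPath P a U' p) (hq : IsRegularRandomPath P b V' q)
    (h₀ : ∀ α : ℝ, ∫ ω, cost ρ θ T (F ω) (G ω) ∂P ≤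
      ∫ ω, cost ρ θ T (fun t ↦ F ω t + α * p ω t) (G ω) ∂P)
    (h₁ : ∀ α : ℝ, ∫ ω, cost ρ θ T (fun t ↦ F ω t + p ω t) (fun t ↦ G ω t + q ω t) ∂P ≤
      ∫ ω, cost ρ θ T (fun t ↦ F ω t + α * p ω t) (fun t ↦ G ω t + q ω t) ∂P) :
    2 * ∫ ω, squareTerm ρ θ T (p ω) ∂P + ∫ ω, crossTerm ρ T (p ω) (q ω) ∂P = 0 := by
  obtain ⟨A, B, C, h⟩ := integral_cost_add_mul (θ := θ) hT hρ hF hG hp hq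
  have hB : B = 0 := by
    refine eq_zero_of_forall_quadratic_nonneg
      (c := ∫ ω, squareTerm ρ θ T (p ω) ∂P) fun α ↦ ?_
    have h1 := h 0 0
    have h2 := h α 0
    simp only [zero_mul, add_zero, mul_zero, ne_eq, OfNat.ofNat_ne_zero, not_false_eq_true,
      zero_pow] at h1 h2
    have := h₀ α
    rw [h1, h2] at this
    linarith
  -- With `β = 1` fixed, expanding around `α = 1` produces this linear coefficient.
  have hS : B + (2 * ∫ ω, squareTerm ρ θ T (p ω) ∂P + ∫ ω, crossTerm ρ T (p ω) (q ω) ∂P) = 0 := by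
    refine eq_zero_of_forall_quadratic_nonneg
      (c := ∫ ω, squareTerm ρ θ T (p ω) ∂P) fun α ↦ ?_
    have h1 := h 1 1
    have h2 := h (1 + α) 1
    simp only [one_mul] at h1 h2
    have := h₁ (1 + α)
    rw [h1, h2] at this
    linarith
  linarith

/-- The total second-order term of both players is a positive definite form. -/
lemma second_order_eq {f g : ℝ → ℝ} (hT : 0 < T) (hρ : 0 < ρ) (hf : IsRegularPath x U f)
    (hg : IsRegularPath y V g) :
    2 * squareTerm ρ θ T f + crossTerm ρ T f g + (2 * squareTerm ρ θ T g + crossTerm ρ T g f) =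
      1 / 2 * kernelForm (expKernel ρ) T f f + 1 / 2 * kernelForm (expKernel ρ) T g g
        + 1 / 2 * kernelForm (expKernel ρ) T (fun t ↦ f t + 1 * g t) (fun t ↦ f t + 1 * g t)
        + 2 * θ * (kernelForm diagKernel T f f + kernelForm diagKernel T g g) := by
  have hE := isDyadicKernel_expKernel hT hρ
  rw [kernelForm_add_mul_left hT hE hf hg (hf.add_mul hg 1),
    kernelForm_add_mul_right hT hE hf hg hf, kernelForm_add_mul_right hT hE hf hg hg,
    kernelForm_comm hT hE (expKernel_symm ρ) hg hf, squareTerm, squareTerm, crossTerm, crossTerm,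
    kernelForm_comm hT (isDyadicKernel_diagKernel hT) diagKernel_symm hg hf,
    ← kernelForm_causal_add_causal hT hρ hf hg]
  ring

lemma ae_eq_of_second_order_eq_zero [IsFiniteMeasure P] (hT : 0 < T) (hρ : 0 < ρ) (hθ : 0 ≤ θ)
    (hp : IsRegularRandomPath P a U p) (hq : IsRegularRandomPath P b V q)
    (h₁ : 2 * ∫ ω, squareTerm ρ θ T (p ω) ∂P + ∫ ω, crossTerm ρ T (p ω) (q ω) ∂P = 0)
    (h₂ : 2 * ∫ ω, squareTerm ρ θ T (q ω) ∂P + ∫ ω, crossTerm ρ T (q ω) (p ω) ∂P = 0) :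
    ∀ᵐ ω ∂P, ∀ t ∈ Icc 0 T, p ω t = a ∧ q ω t = b := by
  have hpq := ((integrable_squareTerm (θ := θ) hT hρ hp).const_mul 2).add
    (integrable_crossTerm hT hρ hp hq)
  have hqp := ((integrable_squareTerm (θ := θ) hT hρ hq).const_mul 2).add
    (integrable_crossTerm hT hρ hq hp)
  have hint := hpq.add hqp
  have h0 : ∫ ω, (2 * squareTerm ρ θ T (p ω) + crossTerm ρ T (p ω) (q ω)
      + (2 * squareTerm ρ θ T (q ω) + crossTerm ρ T (q ω) (p ω))) ∂P = 0 := by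
    rw [← integral_const_mul, ← integral_add ((integrable_squareTerm hT hρ hp).const_mul 2)
      (integrable_crossTerm hT hρ hp hq)] at h₁
    rw [← integral_const_mul, ← integral_add ((integrable_squareTerm hT hρ hq).const_mul 2)
      (integrable_crossTerm hT hρ hq hp)] at h₂
    exact (integral_add hpq hqp).trans (by simpa using congrArg₂ (· + ·) h₁ h₂)
  have hnn (ω : Ω) (h : IsRegularPath a U (p ω)) (h' : IsRegularPath b V (q ω)) :
      0 ≤ kernelForm (expKernel ρ) T (p ω) (p ω) ∧ 0 ≤ kernelForm (expKernel ρ) T (q ω) (q ω) ∧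
      1 / 2 * kernelForm (expKernel ρ) T (p ω) (p ω) +
        1 / 2 * kernelForm (expKernel ρ) T (q ω) (q ω) ≤
      2 * squareTerm ρ θ T (p ω) + crossTerm ρ T (p ω) (q ω)
        + (2 * squareTerm ρ θ T (q ω) + crossTerm ρ T (q ω) (p ω)) := by
    refine ⟨kernelForm_exp_self_nonneg hT hρ h, kernelForm_exp_self_nonneg hT hρ h', ?_⟩
    rw [second_order_eq hT hρ h h']
    have h1 := kernelForm_exp_self_nonneg hT hρ (h.add_mul h' 1)
    have h2 := mul_nonneg hθ (add_nonneg (kernelForm_diag_self_nonneg hT h)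
      (kernelForm_diag_self_nonneg hT h'))
    linarith
  have hae := (integral_eq_zero_iff_of_nonneg_ae (by
    filter_upwards [hp.ae_regular, hq.ae_regular] with ω h h'
    obtain ⟨h1, h2, h3⟩ := hnn ω h h'
    exact le_trans (show (0 : ℝ) ≤ _ by linarith) h3) hint).1 h0
  filter_upwards [hae, hp.ae_regular, hq.ae_regular] with ω h0 h h' t ht
  obtain ⟨h1, h2, h3⟩ := hnn ω h h'
  have h0 : 2 * squareTerm ρ θ T (p ω) + crossTerm ρ T (p ω) (q ω)
      + (2 * squareTerm ρ θ T (q ω) + crossTerm ρ T (q ω) (p ω)) = 0 := h0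
  exact ⟨eq_of_kernelForm_exp_self_eq_zero hT hρ h (by linarith) ht,
    eq_of_kernelForm_exp_self_eq_zero hT hρ h' (by linarith) ht⟩

/-! ### Admissible strategies as random paths, and comparison of two equilibria. -/

lemma continuousWithinAt_extendPath {z : ℝ} {Z : ℝ≥0 → ℝ}
    (hZ : ∀ t, ContinuousWithinAt Z (Ici t) t) (t : ℝ) :
    ContinuousWithinAt (extendPath z Z) (Ici t) t := by
  rcases lt_or_ge t 0 with ht | ht
  · refine (continuousAt_const (y := z)).congr ?_ |>.continuousWithinAt
    filter_upwards [Iio_mem_nhds ht] with s hs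
    exact (if_pos hs).symm
  · refine ((hZ t.toNNReal).comp (t := Ici t.toNNReal) (f := Real.toNNReal) (s := Ici t)
      continuous_real_toNNReal.continuousWithinAt
      fun s hs ↦ Real.toNNReal_le_toNNReal hs).congr (fun s hs ↦ ?_) ?_
    · exact if_neg (not_lt.2 (ht.trans hs))
    · exact if_neg (not_lt.2 ht)

variable {𝓕 : Filtration ℝ≥0 m} {z : ℝ} {Z Z' : ℝ≥0 → Ω → ℝ}

lemma IsAdmissible.exists_isRegularRandomPath (hZ : IsAdmissible P 𝓕 z T Z) :
    ∃ V, IsRegularRandomPath P z V fun ω ↦ extendPath z fun t ↦ Z t ω := by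
  obtain ⟨V, hV⟩ := hZ.boundedVariation
  refine ⟨V, fun t ↦ ?_, ?_⟩
  · unfold extendPath
    split_ifs
    · exact measurable_const
    · exact hZ.adapted.measurable
  · filter_upwards [hV, hZ.rightContinuous] with ω h h'
    exact ⟨h, continuousWithinAt_extendPath h', fun t ht ↦ if_pos ht⟩

/-- The path of the difference of two strategies. -/
def pathDiff (z : ℝ) (Z Z' : ℝ≥0 → Ω → ℝ) (ω : Ω) (t : ℝ) : ℝ :=
  extendPath z (fun t ↦ Z' t ω) t + -1 * extendPath z (fun t ↦ Z t ω) t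

lemma extendPath_add_mul_sub (α : ℝ) (ω : Ω) :
    extendPath z (fun t ↦ Z t ω + α * (Z' t ω - Z t ω)) =
      fun t ↦ extendPath z (fun t ↦ Z t ω) t + α * pathDiff z Z Z' ω t := by
  ext t
  unfold pathDiff extendPath
  split_ifs <;> ring

lemma extendPath_eq_add_pathDiff (ω : Ω) : extendPath z (fun t ↦ Z' t ω) =
    fun t ↦ extendPath z (fun t ↦ Z t ω) t + pathDiff z Z Z' ω t := by
  ext t
  unfold pathDiff
  ring

/-- The admissible class is affine, so deviations of either sign are permitted and optimality yields
equalities. -/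
lemma IsAdmissible.add_mul_sub (hZ : IsAdmissible P 𝓕 z T Z) (hZ' : IsAdmissible P 𝓕 z T Z')
    (α : ℝ) : IsAdmissible P 𝓕 z T fun t ω ↦ Z t ω + α * (Z' t ω - Z t ω) where
  adapted t := (hZ.adapted t).add (((hZ'.adapted t).sub (hZ.adapted t)).const_mul α)
  rightContinuous := by
    filter_upwards [hZ.rightContinuous, hZ'.rightContinuous] with ω h h' t
    exact (h t).add (((h' t).sub (h t)).const_mul α)
  bounded := by
    obtain ⟨C, hC⟩ := hZ.bounded
    obtain ⟨C', hC'⟩ := hZ'.bounded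
    refine ⟨C + |α| * (C' + C), ?_⟩
    filter_upwards [hC, hC'] with ω h h' t
    refine (abs_add_le _ _).trans (add_le_add (h t) ?_)
    rw [abs_mul]
    gcongr
    exact (abs_sub _ _).trans (add_le_add (h' t) (h t))
  boundedVariation := by
    obtain ⟨V, hV⟩ := hZ.exists_isRegularRandomPath
    obtain ⟨V', hV'⟩ := hZ'.exists_isRegularRandomPath
    refine ⟨V + ‖α‖₊ * (V' + ‖(-1 : ℝ)‖₊ * V), ?_⟩
    filter_upwards [(hV.add_mul (hV'.add_mul hV (-1)) α).ae_regular] with ω h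
    rw [extendPath_add_mul_sub]
    exact h.variation_le
  liquidation := by
    filter_upwards [hZ.liquidation, hZ'.liquidation] with ω h h' t ht
    simp [h t ht, h' t ht]

/-- The value `z + -1 * z` is the initial value, namely zero, that `IsRegularRandomPath.add_mul`
gives to a difference. From `T` on, liquidation makes both strategies vanish. -/
lemma eq_of_pathDiff_eq {ω : Ω} (hZ : ∀ t : ℝ≥0, T ≤ t → Z t ω = 0)
    (hZ' : ∀ t : ℝ≥0, T ≤ t → Z' t ω = 0)
    (h : ∀ t ∈ Icc 0 T, pathDiff z Z Z' ω t = z + -1 * z) (t : ℝ≥0) : Z t ω = Z' t ω := by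
  rcases le_total T t with ht | ht
  · rw [hZ t ht, hZ' t ht]
  · have := h t ⟨t.2, ht⟩
    simp only [pathDiff, extendPath, NNReal.coe_nonneg, not_lt.2,
      Real.toNNReal_coe, if_false] at this
    linarith

lemma IsNashEquilibrium.swap {X Y : ℝ≥0 → Ω → ℝ} (h : IsNashEquilibrium P 𝓕 ρ θ T x y X Y) :
    IsNashEquilibrium P 𝓕 ρ θ T y x Y X :=
  ⟨h.admissible_right, h.admissible_left, h.optimal_right, h.optimal_left⟩

/-- Both equilibria are tested along the same line through `X₀` and `X₁`: the first at `α = 0`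
against `Y₀`, the second at `α = 1` against `Y₁`. -/
lemma IsNashEquilibrium.second_order_eq_zero [IsFiniteMeasure P] {X₀ Y₀ X₁ Y₁ : ℝ≥0 → Ω → ℝ}
    (hT : 0 < T) (hρ : 0 < ρ) (h₀ : IsNashEquilibrium P 𝓕 ρ θ T x y X₀ Y₀)
    (h₁ : IsNashEquilibrium P 𝓕 ρ θ T x y X₁ Y₁) :
    2 * ∫ ω, squareTerm ρ θ T (pathDiff x X₀ X₁ ω) ∂P +
      ∫ ω, crossTerm ρ T (pathDiff x X₀ X₁ ω) (pathDiff y Y₀ Y₁ ω) ∂P = 0 := by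
  obtain ⟨U₀, hX₀⟩ := h₀.admissible_left.exists_isRegularRandomPath
  obtain ⟨U₁, hX₁⟩ := h₁.admissible_left.exists_isRegularRandomPath
  obtain ⟨V₀, hY₀⟩ := h₀.admissible_right.exists_isRegularRandomPath
  obtain ⟨V₁, hY₁⟩ := h₁.admissible_right.exists_isRegularRandomPath
  refine integral_second_order_eq_zero hT hρ hX₀ hY₀ (hX₁.add_mul hX₀ (-1))
    (hY₁.add_mul hY₀ (-1)) (fun α ↦ ?_) (fun α ↦ ?_)
  · have := h₀.optimal_left _ (h₀.admissible_left.add_mul_sub h₁.admissible_left α)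
    simp only [expectedCost, extendPath_add_mul_sub] at this
    exact this
  · have := h₁.optimal_left _ (h₀.admissible_left.add_mul_sub h₁.admissible_left α)
    simp only [expectedCost, extendPath_add_mul_sub] at this
    simp only [extendPath_eq_add_pathDiff (z := x) (Z := X₀) (Z' := X₁),
      extendPath_eq_add_pathDiff (z := y) (Z := Y₀) (Z' := Y₁)] at this
    exact this

end

end MarketImpact

end

theorem mainTheorem7 {Ω : Type*} {m : MeasurableSpace Ω} (P : Measure Ω) [IsProbabilityMeasure P]
    (𝓕 : Filtration ℝ≥0 m) (T ρ θ : ℝ) (hT : 0 < T) (hρ : 0 < ρ) (hθ : 0 ≤ θ) (x y : ℝ)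
    (X₀ Y₀ X₁ Y₁ : ℝ≥0 → Ω → ℝ)
    (h₀ : MarketImpact.IsNashEquilibrium P 𝓕 ρ θ T x y X₀ Y₀)
    (h₁ : MarketImpact.IsNashEquilibrium P 𝓕 ρ θ T x y X₁ Y₁) :
    ∀ᵐ ω ∂P, ∀ t, X₀ t ω = X₁ t ω ∧ Y₀ t ω = Y₁ t ω := by
  obtain ⟨U₀, hX₀⟩ := h₀.admissible_left.exists_isRegularRandomPath
  obtain ⟨U₁, hX₁⟩ := h₁.admissible_left.exists_isRegularRandomPath
  obtain ⟨V₀, hY₀⟩ := h₀.admissible_right.exists_isRegularRandomPath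
  obtain ⟨V₁, hY₁⟩ := h₁.admissible_right.exists_isRegularRandomPath
  have hae := MarketImpact.ae_eq_of_second_order_eq_zero hT hρ hθ (hX₁.add_mul hX₀ (-1))
    (hY₁.add_mul hY₀ (-1)) (h₀.second_order_eq_zero hT hρ h₁)
    (h₀.swap.second_order_eq_zero hT hρ h₁.swap)
  filter_upwards [hae, h₀.admissible_left.liquidation, h₁.admissible_left.liquidation,
    h₀.admissible_right.liquidation, h₁.admissible_right.liquidation] with ω h hX hX' hY hY' t
  exact ⟨MarketImpact.eq_of_pathDiff_eq hX hX' (fun s hs ↦ (h s hs).1) t,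
    MarketImpact.eq_of_pathDiff_eq hY hY' (fun s hs ↦ (h s hs).2) t⟩
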